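/- There is an absolute constant $K>0$ with the following property. Let $n_1,n_2,n_3,F\ge 1$ be integers with $n_{\max}:=\max\{n_1,n_2,n_3,F\}\ge 2$, let $X_{\max},\sigma>0$, and let $X^*=[A^*,B^*,C^*]:=\sum_{f=1}^F a^*_f\circ b^*_f\circ c^*_f\in\mathbb R^{n_1\times n_2\times n_3}$, where $a^*_f,b^*_f,c^*_f$ are the columns of $A^*\in\mathbb R^{n_1\times F}$, $B^*\in\mathbb R^{n_2\times F}$, $C^*\in\mathbb R^{n_3\times F}$, whose entries are bounded in absolute value by $A_{\max}$, $B_{\max}$, $C_{\max}$ respectively, and suppose that the entries of $X^*$ are bounded in absolute value by $X_{\max}/2$. Let $0<m\le n_1n_2n_3$ and $\gamma=m/(n_1n_2n_3)$. The random set $S\subseteq[n_1]\times[n_2]\times[n_3]$ contains each position independently with probability $\gamma$, and for $(i,j,k)\in S$ one observes $Y_{i,j,k}=X^*_{i,j,k}+n_{i,j,k}$, where the $n_{i,j,k}$ are i.i.d. $N(0,\sigma^2)$ and independent of $S$. Put $$Q_D=\frac{2X_{\max}^2}{\sigma^2},\qquad \beta=\max\Big\{1,\,1+\frac{\log\big(\frac{14FA_{\max}B_{\max}C_{\max}}{X_{\max}}+1\big)}{\log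 n_{\max}}\Big\},\qquad \lambda=4\Big(1+\frac{2Q_D}{3}\Big)(\beta+2)\log n_{\max},$$ and $L=2^{\lceil\log_2 (n_{\max}^{\beta})\rceil}$. Let the candidates be the triples $(A,B,C)$ of matrices of sizes $n_1\times F$, $n_2\times F$, $n_3\times F$ such that the entries of $A$ and $B$ belong to the $L$ uniformly spaced points (endpoints included) of $[-A_{\max},A_{\max}]$ and $[-B_{\max},B_{\max}]$ respectively, each entry of $C$ is zero or one of the $L$ uniformly spaced points of $[-C_{\max},C_{\max}]$, and the entries of $[A,B,C]$ are bounded in absolute value by $X_{\max}$. Let $\hat X=[\hat A,\hat B,\hat C]$, where $(\hat A,\hat B,\hat C)$ minimizes $$-\log\prod_{(i,j,k)\in S}\frac1{\sqrt{2\pi\sigma^2}}\exp\Big(-\frac{(Y_{i,j,k}-[A,B,C]_{i,j,k})^2}{2\sigma^2}\Big)+\lambda\|C\|_0$$ over all candidates (ties broken in any measurable way), $\|C\|_0$ being the number of nonzero entries of $C$. Then $$\frac{\mathbb E\,\|X^*-\hat X\|_F^2}{n_1n_2n_3}\le K\,(\beta+2)\,\log(n_{\max})\,(\sigma^2+X_{\max}^2)\,\frac{(n_1+n_2)F+\|C^*\|_0}{m}.$$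 That is, the per-entry mean squared error is $O\big(\log(n_{\max})(\sigma^2+X_{\max}^2)\frac{(n_1+n_2)F+\|C^*\|_0}{m}\big)$, with a constant that depends only, and linearly, on $\beta$. -/

import Mathlib

open MeasureTheory ProbabilityTheory

namespace SparseCP

/-- Real third-order tensors of size `n₁ × n₂ × n₃`. -/
abbrev Tensor (n₁ n₂ n₃ : ℕ) : Type := Fin n₁ → Fin n₂ → Fin n₃ → ℝ

/-- Positions of the entries of an `n₁ × n₂ × n₃` tensor. -/
abbrev Index (n₁ n₂ n₃ : ℕ) : Type := Fin n₁ × Fin n₂ × Fin n₃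

/-- The tensor `[A, B, C] = ∑ f, a_f ∘ b_f ∘ c_f` with the given CP factors. -/
def cp {n₁ n₂ n₃ F : ℕ} (A : Matrix (Fin n₁) (Fin F) ℝ) (B : Matrix (Fin n₂) (Fin F) ℝ)
    (C : Matrix (Fin n₃) (Fin F) ℝ) : Tensor n₁ n₂ n₃ :=
  fun i j k => ∑ f, A i f * B j f * C k f

/-- The squared Frobenius norm of a tensor. -/
def frobSq {n₁ n₂ n₃ : ℕ} (X : Tensor n₁ n₂ n₃) : ℝ := ∑ i, ∑ j, ∑ k, X i j k ^ 2

/-- The number `‖M‖₀` of nonzero entries of a matrix. -/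
noncomputable def nnzCount {a b : ℕ} (M : Matrix (Fin a) (Fin b) ℝ) : ℕ :=
  Set.ncard {p : Fin a × Fin b | M p.1 p.2 ≠ 0}

/-- The largest dimension `n_max = max {n₁, n₂, n₃, F}`. -/
def nMax (n₁ n₂ n₃ F : ℕ) : ℕ := max (max n₁ n₂) (max n₃ F)

/-- The number of quantization levels `2 ^ ⌈log₂ (N ^ β)⌉`. -/
noncomputable def numLevels (N : ℕ) (β : ℝ) : ℕ := 2 ^ ⌈Real.logb 2 ((N : ℝ) ^ β)⌉₊

/-- The `L` uniformly spaced points `-M = x₀ < x₁ < ⋯ < x_{L-1} = M` of the interval `[-M, M]`. -/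
def grid (L : ℕ) (M : ℝ) : Set ℝ :=
  {x | ∃ t : ℕ, t < L ∧ x = -M + (t : ℝ) * (2 * M / ((L : ℝ) - 1))}

/-- `[A, B, C]` is a candidate: the entries of `A` and `B` lie on the uniform grids with `L` levels,
those of `C` are zero or lie on the grid, and the entries of `[A, B, C]` are at most `Xmax` in
absolute value. The tensors `[A, B, C]` of all candidates form the full class of candidate
estimates. -/
def IsCandidate {n₁ n₂ n₃ F : ℕ} (L : ℕ) (Amax Bmax Cmax Xmax : ℝ)
    (A : Matrix (Fin n₁) (Fin F) ℝ) (B : Matrix (Fin n₂) (Fin F) ℝ)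
    (C : Matrix (Fin n₃) (Fin F) ℝ) : Prop :=
  (∀ i f, A i f ∈ grid L Amax) ∧
  (∀ j f, B j f ∈ grid L Bmax) ∧
  (∀ k f, C k f = 0 ∨ C k f ∈ grid L Cmax) ∧
  (∀ i j k, |cp A B C i j k| ≤ Xmax)

open Classical in
/-- The likelihood `p_{X_S}(Y_S)`: the product over the sampled entries of the density at the
observation of the normal distribution with mean the entry of `X` and variance `σ²`. -/
noncomputable def likelihood {n₁ n₂ n₃ : ℕ} (σ : ℝ) (X : Tensor n₁ n₂ n₃)
    (S : Set (Index n₁ n₂ n₃)) (Y : Tensor n₁ n₂ n₃) : ℝ :=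
  ∏ p : Index n₁ n₂ n₃ with p ∈ S,
    gaussianPDFReal (X p.1 p.2.1 p.2.2) (σ ^ 2).toNNReal (Y p.1 p.2.1 p.2.2)

/-- The penalized negative log-likelihood `-log p_{X_S}(Y_S) + lam ‖C‖₀` at `X = [A, B, C]`. -/
noncomputable def objective {n₁ n₂ n₃ F : ℕ} (σ lam : ℝ) (S : Set (Index n₁ n₂ n₃))
    (Y : Tensor n₁ n₂ n₃) (A : Matrix (Fin n₁) (Fin F) ℝ) (B : Matrix (Fin n₂) (Fin F) ℝ)
    (C : Matrix (Fin n₃) (Fin F) ℝ) : ℝ :=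
  -Real.log (likelihood σ (cp A B C) S Y) + lam * (nnzCount C : ℝ)

/-- `Xhat` is a complexity-regularized maximum likelihood estimate from the observations of the
entries of `Y` in `S`: it is `[A, B, C]` for a candidate `(A, B, C)` that minimizes the penalized
negative log-likelihood among all candidates. -/
def IsEstimate {n₁ n₂ n₃ : ℕ} (F L : ℕ) (Amax Bmax Cmax Xmax σ lam : ℝ)
    (S : Set (Index n₁ n₂ n₃)) (Y Xhat : Tensor n₁ n₂ n₃) : Prop :=
  ∃ (A : Matrix (Fin n₁) (Fin F) ℝ) (B : Matrix (Fin n₂) (Fin F) ℝ)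
    (C : Matrix (Fin n₃) (Fin F) ℝ),
    IsCandidate L Amax Bmax Cmax Xmax A B C ∧ Xhat = cp A B C ∧
    ∀ (A' : Matrix (Fin n₁) (Fin F) ℝ) (B' : Matrix (Fin n₂) (Fin F) ℝ)
      (C' : Matrix (Fin n₃) (Fin F) ℝ),
      IsCandidate L Amax Bmax Cmax Xmax A' B' C' →
        objective σ lam S Y A B C ≤ objective σ lam S Y A' B' C'

/-- The observation model: `S` contains every position independently with probability `γ`, the noise
variables are i.i.d. normal with mean `0` and variance `σ²` and independent of `S`, and `Y` is the
noisy version of `X` at the positions in `S` (its other entries are arbitrary). -/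
structure IsObservation {n₁ n₂ n₃ : ℕ} {Ω : Type*} [MeasurableSpace Ω] (P : Measure Ω)
    (X : Tensor n₁ n₂ n₃) (σ : ℝ) (γ : unitInterval) (S : Ω → Set (Index n₁ n₂ n₃))
    (noise : Index n₁ n₂ n₃ → Ω → ℝ) (Y : Ω → Tensor n₁ n₂ n₃) : Prop where
  sampling : IsSetBernoulli S Set.univ γ P
  noise_law : ∀ p, HasLaw (noise p) (gaussianReal 0 (σ ^ 2).toNNReal) P
  noise_indep : iIndepFun noise P
  sampling_noise_indep : IndepFun S (fun ω p => noise p ω) P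
  observed : ∀ ω, ∀ p ∈ S ω, Y ω p.1 p.2.1 p.2.2 = X p.1 p.2.1 p.2.2 + noise p ω

end SparseCP

/-! A tempered likelihood ratio controls penalized maximum likelihood over a finite class. Let `llr`
be the negative log-likelihood ratio of a tensor differing from the truth by d, and v = σ². Sampling
and noise integrate out explicitly: for 0 ≤ t ≤ 1/2 and entries with t d_p² ≤ 2v, E exp(-t llr) ≤
exp(-c‖d‖²) with c = γt/(8v) (`integral_exp_neg_llr_le`). If the weights exp(-pen) sum to at most M,
then E Σ exp(-pen + c‖d‖² - t llr) ≤ M. The summand of the estimate is below the whole sum, however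
the data select it; x + 1 ≤ exp x and minimality then bound c E‖d‖² by the expected objective of one
fixed competitor (`oracle_inequality`).

The competitor rounds the true factors to the grids and keeps the zeros of C, with entrywise error
at most Xmax/n_max (`exists_quantization`, `quantization_error_le`). The weights come from a code
that charges log L for each entry of A and B and tλ for each nonzero entry of C
(`sum_exp_neg_length_le`). The charge for A and B is the same for all candidates, so the estimate
also minimizes the objective with code length as penalty. With t = 1/(2(1 + 2Q_D/3)), the factor
σ²/t is of order σ² + Xmax², which is the scale of the final bound (`risk_bound`). -/

namespace SparseCP

/-! ### Exponential moments of the likelihood ratio and the oracle inequality. -/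

section Probability

variable {ι : Type*} [Fintype ι]

/-- A product over the positions factorizes under the law of a Bernoulli random set. -/
lemma integral_setBernoulli_prod (γ : unitInterval) (g : ι → Prop → ℝ) :
    ∫ s, ∏ i, g i (i ∈ s) ∂(setBernoulli (Set.univ : Set ι) γ) =
      ∏ i, ((γ : ℝ) * g i True + (1 - γ) * g i False) := by
  rw [setBernoulli_eq_map, integral_map (by fun_prop) Measurable.of_discrete.aestronglyMeasurable]
  simp only [Set.mem_ofPred_eq]
  rw [Measure.infinitePi_eq_pi, integral_fintype_prod_eq_prod]
  refine Finset.prod_congr rfl fun i _ => ?_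
  rw [integral_add_measure (Integrable.of_finite) (Integrable.of_finite)]
  simp [integral_smul_nnreal_measure, NNReal.smul_def]

/-- The joint law of the sampled positions and the noise. -/
noncomputable def obsLaw (ι : Type*) [Fintype ι] (γ : unitInterval) (v : NNReal) :
    Measure (Set ι × (ι → ℝ)) :=
  (setBernoulli (Set.univ : Set ι) γ).prod (Measure.pi fun _ => gaussianReal 0 v)

instance (γ : unitInterval) (v : NNReal) : IsProbabilityMeasure (obsLaw ι γ v) := by
  unfold obsLaw; infer_instance

open Classical in
/-- The negative log-likelihood ratio, as a function of the sampled positions `s` and the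
noise `x`, of the tensor that differs from the true one by `d`. -/
noncomputable def llr (v : ℝ) (d : ι → ℝ) (z : Set ι × (ι → ℝ)) : ℝ :=
  ∑ p, if p ∈ z.1 then d p ^ 2 / (2 * v) - d p * z.2 p / v else 0

lemma measurable_llr (v : ℝ) (d : ι → ℝ) : Measurable (llr v d) := by
  refine measurable_from_prod_countable_right fun s => ?_
  unfold llr
  refine Finset.measurable_sum _ fun p _ => ?_
  by_cases hp : p ∈ s <;> simp only [hp, if_true, if_false] <;> fun_prop

lemma integral_exp_mul_gaussian (v : NNReal) (b : ℝ) :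
    ∫ x, Real.exp (b * x) ∂(gaussianReal 0 v) = Real.exp (v * b ^ 2 / 2) := by
  have := congrFun (mgf_id_gaussianReal (μ := 0) (v := v)) b
  simpa [mgf] using this

open Classical in
lemma exp_neg_llr (v t : ℝ) (d : ι → ℝ) (s : Set ι) (x : ι → ℝ) :
    Real.exp (-t * llr v d (s, x)) =
      ∏ p, (if p ∈ s then Real.exp (-t * (d p ^ 2 / (2 * v))) else 1) *
        Real.exp ((if p ∈ s then t * d p / v else 0) * x p) := by
  rw [llr, Finset.mul_sum, Real.exp_sum]
  refine Finset.prod_congr rfl fun p _ => ?_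
  split_ifs
  · rw [← Real.exp_add]; ring_nf
  · simp

lemma integrable_exp_neg_llr_right (v : NNReal) (t : ℝ) (d : ι → ℝ) (s : Set ι) :
    Integrable (fun x => Real.exp (-t * llr v d (s, x)))
      (Measure.pi fun _ => gaussianReal 0 v) := by
  classical
  simp_rw [exp_neg_llr]
  exact Integrable.fintype_prod (f := fun p y => (if p ∈ s then _ else _) *
    Real.exp ((if p ∈ s then t * d p / v else 0) * y))
    fun p => (integrable_exp_mul_gaussianReal _).const_mul _

lemma integrable_exp_neg_llr (γ : unitInterval) (v : NNReal) (t : ℝ) (d : ι → ℝ) :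
    Integrable (fun z => Real.exp (-t * llr v d z)) (obsLaw ι γ v) := by
  unfold obsLaw
  rw [integrable_prod_iff]
  · exact ⟨.of_forall fun s => integrable_exp_neg_llr_right v t d s, Integrable.of_finite⟩
  · exact (((measurable_llr _ _).const_mul _).exp).aestronglyMeasurable

/-- Given the sampled set, each sampled entry contributes exp(-t d²/(2v)) times the Gaussian moment
exp(t² d²/(2v)); averaging over the set mixes this with 1. -/
lemma integral_exp_neg_llr (γ : unitInterval) {v : NNReal} (hv : v ≠ 0) (t : ℝ) (d : ι → ℝ) :
    ∫ z, Real.exp (-t * llr v d z) ∂(obsLaw ι γ v) =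
      ∏ p, ((γ : ℝ) * Real.exp (-(t * (1 - t) * d p ^ 2 / (2 * v))) + (1 - γ)) := by
  classical
  have h := integrable_exp_neg_llr γ v t d
  unfold obsLaw at h ⊢
  rw [integral_prod _ h]
  have hr (s : Set ι) : ∫ x, Real.exp (-t * llr v d (s, x)) ∂(Measure.pi fun _ : ι =>
      gaussianReal 0 v) =
      ∏ p, if p ∈ s then Real.exp (-(t * (1 - t) * d p ^ 2 / (2 * v))) else 1 := by
    simp_rw [exp_neg_llr]
    rw [integral_fintype_prod_eq_prod (f := fun p y => (if p ∈ s then _ else _) *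
      Real.exp ((if p ∈ s then t * d p / v else 0) * y))]
    refine Finset.prod_congr rfl fun p _ => ?_
    rw [integral_const_mul, integral_exp_mul_gaussian]
    split_ifs
    · rw [← Real.exp_add]
      congr 1
      have : (v : ℝ) ≠ 0 := by exact_mod_cast hv
      field_simp
      ring
    · simp
  simp_rw [hr]
  rw [integral_setBernoulli_prod γ (fun p q => if q then _ else 1)]
  simp

/-- On [0, 1], exp(-u) ≤ 1/(1 + u) ≤ 1 - u/2, so the mixture is at most 1 - γu/2. -/
lemma mix_exp_neg_le {γ u : ℝ} (hγ : 0 ≤ γ) (hu : 0 ≤ u) (hu1 : u ≤ 1) :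
    γ * Real.exp (-u) + (1 - γ) ≤ Real.exp (-(γ * (u / 2))) := by
  have h1 : Real.exp (-u) ≤ 1 - u / 2 := by
    have h2 := Real.add_one_le_exp u
    rw [Real.exp_neg]
    calc (Real.exp u)⁻¹ ≤ (u + 1)⁻¹ := inv_anti₀ (by linarith) h2
      _ ≤ 1 - u / 2 := by
        rw [inv_le_iff_one_le_mul₀ (by linarith)]
        nlinarith
  have h3 := Real.add_one_le_exp (-(γ * (u / 2)))
  nlinarith

lemma integral_exp_neg_llr_le (γ : unitInterval) {v : NNReal} (hv : v ≠ 0) {t D : ℝ} (ht : 0 ≤ t)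
    (ht2 : t ≤ 1 / 2) (htD : t * D ^ 2 ≤ 2 * v) (d : ι → ℝ) (hd : ∀ p, |d p| ≤ D) :
    ∫ z, Real.exp (-t * llr v d z) ∂(obsLaw ι γ v) ≤
      Real.exp (-(γ * t / (8 * v) * ∑ p, d p ^ 2)) := by
  have hv' : (0 : ℝ) < v := by exact_mod_cast pos_iff_ne_zero.mpr hv
  rw [integral_exp_neg_llr γ hv, Finset.mul_sum, ← Finset.sum_neg_distrib, Real.exp_sum]
  have h1γ : (0 : ℝ) ≤ 1 - γ := sub_nonneg.mpr γ.2.2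
  refine Finset.prod_le_prod
    (fun p _ => add_nonneg (mul_nonneg γ.2.1 (Real.exp_pos _).le) h1γ) fun p _ => ?_
  have hdD : d p ^ 2 ≤ D ^ 2 := sq_le_sq' (by linarith [(abs_le.1 (hd p)).1]) (abs_le.1 (hd p)).2
  have htd : t * d p ^ 2 ≤ 2 * v := (mul_le_mul_of_nonneg_left hdD ht).trans htD
  have htd0 : 0 ≤ t * d p ^ 2 := by positivity
  refine (mix_exp_neg_le γ.2.1 ?_ ?_).trans (Real.exp_le_exp.2 (neg_le_neg ?_))
  · have : 0 ≤ 1 - t := by linarith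
    positivity
  · rw [div_le_one (by positivity)]
    nlinarith
  -- The 8 is 2·2·2: the Gaussian 2v, the bound 1 - t ≥ 1/2, and the loss u/2 from mixing.
  · have e1 : (γ : ℝ) * t / (8 * v) * d p ^ 2 = γ * ((t * d p ^ 2 * (1 / 2) / (2 * v)) / 2) := by
      field_simp; ring
    rw [e1]
    refine mul_le_mul_of_nonneg_left ?_ γ.2.1
    gcongr ?_ / _ / _
    nlinarith

open Classical in
lemma integral_obsLaw_mem (γ : unitInterval) (v : NNReal) (p : ι) (a b : ℝ) :
    Integrable (fun z : Set ι × (ι → ℝ) => if p ∈ z.1 then a + b * z.2 p else 0) (obsLaw ι γ v) ∧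
    ∫ z, (if p ∈ z.1 then a + b * z.2 p else 0) ∂(obsLaw ι γ v) = γ * a := by
  have hx : Integrable (fun x : ι → ℝ => a + b * x p) (Measure.pi fun _ => gaussianReal 0 v) := by
    have h1 : Integrable (fun x : ℝ => a + b * x) (gaussianReal 0 v) :=
      (integrable_const _).add ((memLp_id_gaussianReal 1).integrable le_rfl |>.const_mul b)
    exact (measurePreserving_eval (fun _ : ι => gaussianReal 0 v) p).integrable_comp_of_integrable h1
  have hm : ∫ x : ι → ℝ, a + b * x p ∂(Measure.pi fun _ => gaussianReal 0 v) = a := by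
    have h2 := integral_comp_eval (μ := fun _ : ι => gaussianReal 0 v) (i := p)
      (f := fun x : ℝ => a + b * x) (by fun_prop)
    have h3 : Integrable (fun x : ℝ => x) (gaussianReal 0 v) :=
      (memLp_id_gaussianReal 1).integrable le_rfl
    rw [h2, integral_add (integrable_const _) (h3.const_mul b), integral_const_mul]
    simp
  have e : (fun z : Set ι × (ι → ℝ) => if p ∈ z.1 then a + b * z.2 p else 0) =
      fun z => (if p ∈ z.1 then 1 else 0) * (a + b * z.2 p) := by
    ext z; split_ifs <;> simp
  have hs : ∫ s, (if p ∈ s then 1 else 0 : ℝ) ∂(setBernoulli (Set.univ : Set ι) γ) = γ := by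
    -- The indicator of p ∈ s as a product whose other factors are 1.
    have h3 := integral_setBernoulli_prod γ (fun q r => if q = p then (if r then 1 else 0) else 1)
    have h4 (s : Set ι) : ∏ q, (if q = p then (if q ∈ s then 1 else 0) else 1 : ℝ) =
        if p ∈ s then 1 else 0 := by
      rw [Finset.prod_ite_eq' Finset.univ p fun q => if q ∈ s then (1 : ℝ) else 0]; simp
    rw [← integral_congr_ae (.of_forall h4), h3, Finset.prod_eq_single p] <;> simp +contextual
  rw [e]
  unfold obsLaw
  refine ⟨Integrable.mul_prod (f := fun s : Set ι => if p ∈ s then (1 : ℝ) else 0)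
    Integrable.of_finite hx, ?_⟩
  rw [integral_prod_mul (fun s : Set ι => if p ∈ s then (1 : ℝ) else 0)
    (fun x : ι → ℝ => a + b * x p), hs, hm]

lemma integral_llr (γ : unitInterval) (v : NNReal) (d : ι → ℝ) :
    Integrable (llr v d) (obsLaw ι γ v) ∧
    ∫ z, llr v d z ∂(obsLaw ι γ v) = γ / (2 * v) * ∑ p, d p ^ 2 := by
  classical
  have h (p : ι) := integral_obsLaw_mem γ v p (d p ^ 2 / (2 * v)) (-(d p / v))
  have e : llr (v : ℝ) d = fun z => ∑ p, if p ∈ z.1 then d p ^ 2 / (2 * v) + -(d p / v) * z.2 p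
      else 0 := by
    ext z
    refine Finset.sum_congr rfl fun p _ => ?_
    split_ifs <;> ring
  rw [e]
  refine ⟨integrable_finsetSum _ fun p _ => (h p).1, ?_⟩
  rw [integral_finsetSum _ fun p _ => (h p).1, Finset.mul_sum]
  exact Finset.sum_congr rfl fun p _ => by rw [(h p).2]; ring

/-- Oracle inequality for penalized maximum likelihood over a finite class. -/
lemma oracle_inequality {Ω Θ : Type*} [MeasurableSpace Ω] {P : Measure Ω} {γ : unitInterval}
    {v : NNReal} (hv : v ≠ 0) {Z : Ω → Set ι × (ι → ℝ)} (hZ : HasLaw Z (obsLaw ι γ v) P)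
    {t D M : ℝ} (ht : 0 ≤ t) (ht2 : t ≤ 1 / 2) (htD : t * D ^ 2 ≤ 2 * v)
    (T : Finset Θ) (d : Θ → ι → ℝ) (hd : ∀ θ ∈ T, ∀ p, |d θ p| ≤ D)
    (pen : Θ → ℝ) (hpen : ∑ θ ∈ T, Real.exp (-pen θ) ≤ M)
    (d₀ : ι → ℝ) (pen₀ : ℝ) {err : Ω → ℝ} (herr : Integrable err P)
    (hmin : ∀ᵐ ω ∂P, ∃ θ ∈ T, err ω = ∑ p, d θ p ^ 2 ∧
      t * llr v (d θ) (Z ω) + pen θ ≤ t * llr v d₀ (Z ω) + pen₀) :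
    γ * t / (8 * v) * ∫ ω, err ω ∂P ≤ M + γ * t / (2 * v) * ∑ p, d₀ p ^ 2 + pen₀ := by
  have : IsProbabilityMeasure P := hZ.isProbabilityMeasure
  set c : ℝ := γ * t / (8 * v) with hc
  set G : Set ι × (ι → ℝ) → ℝ := fun z => ∑ θ ∈ T,
    Real.exp (-pen θ + c * ∑ p, d θ p ^ 2) * Real.exp (-t * llr v (d θ) z) with hG
  have hGi : Integrable G (obsLaw ι γ v) :=
    integrable_finsetSum _ fun θ _ => (integrable_exp_neg_llr γ v t (d θ)).const_mul _
  have hGM : ∫ z, G z ∂(obsLaw ι γ v) ≤ M := by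
    rw [hG, integral_finsetSum _ fun θ _ =>
      (integrable_exp_neg_llr γ v t (d θ)).const_mul _]
    refine (Finset.sum_le_sum fun θ hθ => ?_).trans hpen
    rw [integral_const_mul]
    calc _ ≤ _ := mul_le_mul_of_nonneg_left
          (integral_exp_neg_llr_le γ hv ht ht2 htD (d θ) (hd θ hθ)) (Real.exp_pos _).le
      _ = Real.exp (-pen θ) := by rw [← Real.exp_add]; congr 1; ring
  set H : Set ι × (ι → ℝ) → ℝ := fun z => G z + (t * llr v d₀ z + pen₀) with hH
  have hl := integral_llr γ v d₀
  have hli : Integrable (fun z => t * llr v d₀ z + pen₀) (obsLaw ι γ v) :=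
    (hl.1.const_mul t).add (integrable_const _)
  have hHi : Integrable H (obsLaw ι γ v) := hGi.add hli
  have hHZ : Integrable (fun ω => H (Z ω)) P := by
    have := hZ.map_eq ▸ hHi
    exact this.comp_aemeasurable hZ.aemeasurable
  have hle : ∫ ω, c * err ω ∂P ≤ ∫ ω, H (Z ω) ∂P := by
    refine integral_mono_ae (herr.const_mul c) hHZ ?_
    filter_upwards [hmin] with ω ⟨θ, hθ, he, hm⟩
    -- Here θ depends on ω; the sum over `T` does not, so no independence of the selection is
    -- needed.
    have h1 : Real.exp (-pen θ + c * ∑ p, d θ p ^ 2) * Real.exp (-t * llr v (d θ) (Z ω)) ≤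
        G (Z ω) := Finset.single_le_sum (f := fun θ => Real.exp (-pen θ + c * ∑ p, d θ p ^ 2) *
          Real.exp (-t * llr v (d θ) (Z ω))) (fun _ _ => by positivity) hθ
    rw [← Real.exp_add] at h1
    have h2 := Real.add_one_le_exp (-pen θ + c * ∑ p, d θ p ^ 2 + -t * llr v (d θ) (Z ω))
    simp only [hH, he]
    linarith
  have hHe : ∫ ω, H (Z ω) ∂P = ∫ z, H z ∂(obsLaw ι γ v) :=
    hZ.integral_comp hHi.aestronglyMeasurable
  rw [integral_const_mul, hHe, hH, integral_add hGi hli,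
    integral_add (hl.1.const_mul t) (integrable_const _), integral_const_mul, hl.2] at hle
  simp only [integral_const, probReal_univ, one_smul] at hle
  have : t * (γ / (2 * v) * ∑ p, d₀ p ^ 2) = γ * t / (2 * v) * ∑ p, d₀ p ^ 2 := by ring
  linarith

lemma IsObservation.hasLaw {n₁ n₂ n₃ : ℕ} {Ω : Type*} [MeasurableSpace Ω] {P : Measure Ω}
    [IsProbabilityMeasure P] {X : Tensor n₁ n₂ n₃} {σ : ℝ} {γ : unitInterval}
    {S : Ω → Set (Index n₁ n₂ n₃)} {noise : Index n₁ n₂ n₃ → Ω → ℝ} {Y : Ω → Tensor n₁ n₂ n₃}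
    (h : IsObservation P X σ γ S noise Y) :
    HasLaw (fun ω => (S ω, fun p => noise p ω)) (obsLaw (Index n₁ n₂ n₃) γ (σ ^ 2).toNNReal) P :=
  (indepFun_iff_hasLaw_prodMk_prod h.sampling (h.noise_indep.hasLaw_pi h.noise_law)).1
    h.sampling_noise_indep

end Probability

/-! ### Rounding the factors to the grids. -/

section Quantization

lemma exists_grid_near {L : ℕ} (hL : 2 ≤ L) {M a : ℝ} (ha : |a| ≤ M) :
    ∃ x ∈ grid L M, |a - x| ≤ 2 * M / ((L : ℝ) - 1) := by
  obtain ⟨h1, h2⟩ := abs_le.1 ha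
  have hL' : (0 : ℝ) < (L : ℝ) - 1 := by
    have : (2 : ℝ) ≤ L := by exact_mod_cast hL
    linarith
  have hM : 0 ≤ M := by linarith
  -- For M = 0 the spacing vanishes and cannot be divided by. Otherwise a is rounded down.
  rcases hM.eq_or_lt with rfl | hM
  · exact ⟨0, ⟨0, by omega, by simp⟩, by simp; linarith⟩
  have hh : 0 < 2 * M / ((L : ℝ) - 1) := by positivity
  set h := 2 * M / ((L : ℝ) - 1) with hdef
  have hq : 0 ≤ (a + M) / h := div_nonneg (by linarith) hh.le
  have hf := Nat.floor_le hq
  have hf' := Nat.lt_floor_add_one ((a + M) / h)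
  rw [le_div_iff₀ hh] at hf
  rw [div_lt_iff₀ hh] at hf'
  refine ⟨_, ⟨⌊(a + M) / h⌋₊, ?_, rfl⟩, ?_⟩
  · have : (a + M) / h ≤ (L : ℝ) - 1 := by
      rw [div_le_iff₀ hh, hdef]
      field_simp
      linarith
    have h3 : (⌊(a + M) / h⌋₊ : ℝ) < L := by linarith [Nat.floor_le hq]
    exact_mod_cast h3
  · rw [abs_le]
    constructor <;> nlinarith

lemma abs_le_of_mem_grid {L : ℕ} (hL : 2 ≤ L) {M x : ℝ} (hM : 0 ≤ M) (hx : x ∈ grid L M) :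
    |x| ≤ M := by
  obtain ⟨t, ht, rfl⟩ := hx
  have hL' : (0 : ℝ) < (L : ℝ) - 1 := by
    have : (2 : ℝ) ≤ L := by exact_mod_cast hL
    linarith
  have ht' : (t : ℝ) ≤ (L : ℝ) - 1 := by
    have : (t : ℝ) + 1 ≤ L := by exact_mod_cast ht
    linarith
  have h1 : (t : ℝ) * (2 * M / ((L : ℝ) - 1)) ≤ 2 * M := by
    rw [mul_div_assoc', div_le_iff₀ hL']
    nlinarith
  have h2 : 0 ≤ (t : ℝ) * (2 * M / ((L : ℝ) - 1)) := by positivity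
  rw [abs_le]
  constructor <;> linarith

lemma abs_mul_three_sub_le {a b c a' b' c' α β γ δ : ℝ} (hb : |b| ≤ β)
    (hc : |c| ≤ γ) (ha' : |a'| ≤ α) (hb' : |b'| ≤ β) (h1 : |a - a'| ≤ 2 * α / δ)
    (h2 : |b - b'| ≤ 2 * β / δ) (h3 : |c - c'| ≤ 2 * γ / δ) :
    |a' * b' * c' - a * b * c| ≤ 6 * (α * β * γ) / δ := by
  have e : a' * b' * c' - a * b * c =
      -((a - a') * b * c + a' * (b - b') * c + a' * b' * (c - c')) := by ring
  have hα : 0 ≤ α := (abs_nonneg _).trans ha'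
  have hβ : 0 ≤ β := (abs_nonneg _).trans hb
  have hγ : 0 ≤ γ := (abs_nonneg _).trans hc
  rw [e, abs_neg]
  refine (abs_add_three _ _ _).trans ?_
  simp only [abs_mul]
  have := (abs_nonneg _).trans h1
  have := (abs_nonneg _).trans h2
  calc _ ≤ 2 * α / δ * β * γ + α * (2 * β / δ) * γ + α * β * (2 * γ / δ) := by gcongr
    _ = _ := by ring

lemma nnzCount_mono {a b : ℕ} {M M' : Matrix (Fin a) (Fin b) ℝ}
    (h : ∀ i j, M i j = 0 → M' i j = 0) : nnzCount M' ≤ nnzCount M :=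
  Set.ncard_le_ncard (fun _ hp hp' => hp (h _ _ hp')) (Set.toFinite _)

lemma exists_quantization {n₁ n₂ n₃ F L : ℕ} (hL : 2 ≤ L) {Amax Bmax Cmax : ℝ}
    {A : Matrix (Fin n₁) (Fin F) ℝ} {B : Matrix (Fin n₂) (Fin F) ℝ}
    {C : Matrix (Fin n₃) (Fin F) ℝ}
    (hA : ∀ i f, |A i f| ≤ Amax) (hB : ∀ j f, |B j f| ≤ Bmax) (hC : ∀ k f, |C k f| ≤ Cmax) :
    ∃ (A' : Matrix (Fin n₁) (Fin F) ℝ) (B' : Matrix (Fin n₂) (Fin F) ℝ)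
      (C' : Matrix (Fin n₃) (Fin F) ℝ),
      (∀ i f, A' i f ∈ grid L Amax) ∧ (∀ j f, B' j f ∈ grid L Bmax) ∧
      (∀ k f, C' k f = 0 ∨ C' k f ∈ grid L Cmax) ∧ nnzCount C' ≤ nnzCount C ∧
      ∀ i j k, |cp A' B' C' i j k - cp A B C i j k| ≤
        F * (6 * (Amax * Bmax * Cmax) / ((L : ℝ) - 1)) := by
  classical
  choose a ha ha' using fun i f => exists_grid_near hL (hA i f)
  choose b hb hb' using fun i f => exists_grid_near hL (hB i f)
  choose c hc hc' using fun i f => exists_grid_near hL (hC i f)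
  -- Zero need not be a grid point, so zeros of C are kept rather than rounded; otherwise sparsity
  -- would be lost.
  refine ⟨a, b, fun k f => if C k f = 0 then 0 else c k f, ha, hb, fun k f => ?_,
    nnzCount_mono fun k f h => by simp [h], fun i j k => ?_⟩
  · dsimp only
    split_ifs
    · exact .inl rfl
    · exact .inr (hc k f)
  · unfold cp
    rw [← Finset.sum_sub_distrib]
    refine (Finset.abs_sum_le_sum_abs _ _).trans ?_
    refine (Finset.sum_le_card_nsmul _ _ _ fun f _ => ?_).trans_eq
      (by rw [Finset.card_univ, Fintype.card_fin, nsmul_eq_mul])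
    refine abs_mul_three_sub_le (hB j f) (hC k f)
      (abs_le_of_mem_grid hL ((abs_nonneg _).trans (hA i f)) (ha i f))
      (abs_le_of_mem_grid hL ((abs_nonneg _).trans (hB j f)) (hb j f)) (ha' i f) (hb' j f) ?_
    by_cases h : C k f = 0
    · have h0 := (abs_nonneg _).trans (hC k f)
      have : (1 : ℝ) ≤ L := by exact_mod_cast (by omega : 1 ≤ L)
      simpa [h] using div_nonneg (mul_nonneg zero_le_two h0) (by linarith)
    · simpa [h] using hc' k f

end Quantization

/-! ### Codes for the candidates and their Kraft sum. -/

section Codes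

/-- Codes for the candidate triples: grid indices, an entry of `C` being coded by `none` if it
vanishes. -/
abbrev Code (n₁ n₂ n₃ F L : ℕ) : Type :=
  (Fin n₁ × Fin F → Fin L) × (Fin n₂ × Fin F → Fin L) × (Fin n₃ × Fin F → Option (Fin L))

/-- The grid point with index `t`. -/
noncomputable def gridPoint (L : ℕ) (M : ℝ) (t : Fin L) : ℝ :=
  -M + (t : ℝ) * (2 * M / ((L : ℝ) - 1))

/-- The tensor with the given code. -/
noncomputable def Code.decode {n₁ n₂ n₃ F L : ℕ} (Amax Bmax Cmax : ℝ)
    (θ : Code n₁ n₂ n₃ F L) : Tensor n₁ n₂ n₃ :=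
  cp (fun i f => gridPoint L Amax (θ.1 (i, f))) (fun j f => gridPoint L Bmax (θ.2.1 (j, f)))
    (fun k f => (θ.2.2 (k, f)).elim 0 (gridPoint L Cmax))

/-- The length of a code: `ℓ` for every entry of `A` and `B`, and `w` for every nonzero entry
of `C`. -/
noncomputable def Code.length {n₁ n₂ n₃ F L : ℕ} (ℓ w : ℝ) (θ : Code n₁ n₂ n₃ F L) : ℝ :=
  ((n₁ : ℝ) + n₂) * F * ℓ + ∑ q, (θ.2.2 q).elim 0 fun _ => w

lemma exists_code {n₁ n₂ n₃ F L : ℕ} {Amax Bmax Cmax Xmax : ℝ}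
    {A : Matrix (Fin n₁) (Fin F) ℝ} {B : Matrix (Fin n₂) (Fin F) ℝ}
    {C : Matrix (Fin n₃) (Fin F) ℝ} (h : IsCandidate L Amax Bmax Cmax Xmax A B C) (ℓ w : ℝ) :
    ∃ θ : Code n₁ n₂ n₃ F L, θ.decode Amax Bmax Cmax = cp A B C ∧
      θ.length ℓ w = ((n₁ : ℝ) + n₂) * F * ℓ + w * nnzCount C := by
  classical
  obtain ⟨hA, hB, hC, -⟩ := h
  choose a haL ha using hA
  choose b hbL hb using hB
  have hC' : ∀ k f, ∃ o : Option (Fin L), C k f = o.elim 0 (gridPoint L Cmax) ∧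
      (o.elim 0 (fun _ => w) : ℝ) = if C k f ≠ 0 then w else 0 := by
    intro k f
    by_cases h0 : C k f = 0
    · exact ⟨none, by simp [h0], by simp [h0]⟩
    · obtain ⟨t, ht, e⟩ := (hC k f).resolve_left h0
      exact ⟨some ⟨t, ht⟩, by simpa [gridPoint] using e, by simp [h0]⟩
  choose c hc hcw using hC'
  refine ⟨(fun q => ⟨a q.1 q.2, haL _ _⟩, fun q => ⟨b q.1 q.2, hbL _ _⟩, fun q => c q.1 q.2),
    ?_, ?_⟩
  · have e1 : A = fun i f => gridPoint L Amax ⟨a i f, haL i f⟩ := by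
      ext i f; exact ha i f
    have e2 : B = fun i f => gridPoint L Bmax ⟨b i f, hbL i f⟩ := by
      ext i f; exact hb i f
    have e3 : C = fun i f => (c i f).elim 0 (gridPoint L Cmax) := by
      ext i f; exact hc i f
    conv_rhs => rw [e1, e2, e3]
    rfl
  · simp only [Code.length, hcw, nnzCount]
    rw [← Finset.sum_filter, Finset.sum_const, nsmul_eq_mul, mul_comm w]
    congr 3
    rw [← Set.ncard_coe_finset]
    congr 1
    ext q
    simp

/-- The weights of A and B are uniform with total mass 1. Those of C factor over its entries into (1
+ L exp(-w))^(n₃F), which is at most e by the hypothesis on w. -/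
lemma sum_exp_neg_length_le {n₁ n₂ n₃ F L : ℕ} (hL : 1 ≤ L) (w : ℝ)
    (hw : (n₃ : ℝ) * F * (L * Real.exp (-w)) ≤ 1) :
    ∑ θ : Code n₁ n₂ n₃ F L, Real.exp (-θ.length (Real.log L) w) ≤ 3 := by
  have hL0 : (0 : ℝ) < L := by exact_mod_cast hL
  have e (θ : Code n₁ n₂ n₃ F L) : Real.exp (-θ.length (Real.log L) w) =
      ((L : ℝ) ^ ((n₁ + n₂) * F))⁻¹ * ∏ q, (θ.2.2 q).elim 1 fun _ => Real.exp (-w) := by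
    rw [Code.length, neg_add, Real.exp_add, ← Finset.sum_neg_distrib, Real.exp_sum]
    congr 1
    · rw [Real.exp_neg, ← Real.exp_log (pow_pos hL0 _), Real.log_pow]
      push_cast
      rfl
    · refine Finset.prod_congr rfl fun q _ => ?_
      cases θ.2.2 q <;> simp
  simp_rw [e]
  rw [← Finset.mul_sum, Fintype.sum_prod_type]
  simp_rw [Fintype.sum_prod_type]
  have hC : ∑ c : Fin n₃ × Fin F → Option (Fin L), ∏ q, ((c q).elim 1 fun _ => Real.exp (-w) : ℝ) =
      (1 + L * Real.exp (-w)) ^ (n₃ * F) := by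
    rw [← Fintype.piFinset_univ, Finset.sum_prod_piFinset (Finset.univ : Finset (Option (Fin L)))
      (fun (_ : Fin n₃ × Fin F) o => (o.elim 1 fun _ => Real.exp (-w) : ℝ))]
    simp
  simp only [hC, Finset.sum_const, Finset.prod_const,
    Finset.card_univ, Fintype.card_fin, Fintype.card_prod, Fintype.card_pi, nsmul_eq_mul]
  push_cast
  have h1 : (1 + L * Real.exp (-w)) ^ (n₃ * F) ≤ 3 := by
    have h2 : (1 + L * Real.exp (-w)) ^ (n₃ * F) ≤ Real.exp (L * Real.exp (-w)) ^ (n₃ * F) := by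
      gcongr
      linarith [Real.add_one_le_exp (L * Real.exp (-w))]
    refine h2.trans ?_
    rw [← Real.exp_nat_mul]
    push_cast
    refine (Real.exp_le_exp.2 hw).trans ?_
    linarith [Real.exp_one_lt_d9]
  calc _ = (1 + L * Real.exp (-w)) ^ (n₃ * F) := by
        rw [add_mul, pow_add]; field_simp
    _ ≤ 3 := h1

end Codes

/-! ### Gaussian likelihood ratios and the squared error. -/

section Likelihood

lemma log_gaussianPDFReal {μ : ℝ} {v : NNReal} (hv : v ≠ 0) (x : ℝ) :
    Real.log (gaussianPDFReal μ v x) =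
      Real.log (√(2 * Real.pi * v))⁻¹ - (x - μ) ^ 2 / (2 * v) := by
  have : (0 : ℝ) < v := by exact_mod_cast pos_iff_ne_zero.2 hv
  rw [gaussianPDFReal_def, Real.log_mul (by positivity) (Real.exp_pos _).ne', Real.log_exp]
  ring

lemma neg_log_likelihood_sub {n₁ n₂ n₃ : ℕ} {σ : ℝ} (hσ : 0 < σ) (X X' Y : Tensor n₁ n₂ n₃)
    (S : Set (Index n₁ n₂ n₃)) (x : Index n₁ n₂ n₃ → ℝ)
    (hY : ∀ p ∈ S, Y p.1 p.2.1 p.2.2 = X p.1 p.2.1 p.2.2 + x p) :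
    -Real.log (likelihood σ X' S Y) - -Real.log (likelihood σ X S Y) =
      llr (σ ^ 2) (fun p => X' p.1 p.2.1 p.2.2 - X p.1 p.2.1 p.2.2) (S, x) := by
  classical
  have hv : (σ ^ 2).toNNReal ≠ 0 := (Real.toNNReal_pos.2 (by positivity)).ne'
  have hv' : ((σ ^ 2).toNNReal : ℝ) = σ ^ 2 := Real.coe_toNNReal _ (by positivity)
  have hl (X : Tensor n₁ n₂ n₃) : Real.log (likelihood σ X S Y) =
      ∑ p : Index n₁ n₂ n₃ with p ∈ S, (Real.log (√(2 * Real.pi * σ ^ 2))⁻¹ -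
        (Y p.1 p.2.1 p.2.2 - X p.1 p.2.1 p.2.2) ^ 2 / (2 * σ ^ 2)) := by
    rw [likelihood, Real.log_prod fun p _ => (gaussianPDFReal_pos _ _ _ hv).ne']
    exact Finset.sum_congr (by congr) fun p _ => by rw [log_gaussianPDFReal hv, hv']
  rw [hl, hl, llr, neg_sub_neg, ← Finset.sum_sub_distrib, Finset.sum_filter]
  refine Finset.sum_congr rfl fun p _ => ?_
  split_ifs with hp
  · rw [hY p hp]
    field_simp
    ring
  · rfl

lemma frobSq_sub_comm {n₁ n₂ n₃ : ℕ} (X X' : Tensor n₁ n₂ n₃) :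
    frobSq (X - X') = ∑ p : Index n₁ n₂ n₃, (X' p.1 p.2.1 p.2.2 - X p.1 p.2.1 p.2.2) ^ 2 := by
  simp only [frobSq, Fintype.sum_prod_type, Pi.sub_apply]
  exact Finset.sum_congr rfl fun i _ => Finset.sum_congr rfl fun j _ =>
    Finset.sum_congr rfl fun k _ => by ring

lemma integrable_frobSq_sub {n₁ n₂ n₃ : ℕ} {Ω : Type*} [MeasurableSpace Ω] {P : Measure Ω}
    [IsFiniteMeasure P] {X : Tensor n₁ n₂ n₃} {Xhat : Ω → Tensor n₁ n₂ n₃} {D : ℝ}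
    (hm : AEMeasurable Xhat P) (hD : ∀ᵐ ω ∂P, ∀ i j k, |Xhat ω i j k - X i j k| ≤ D) :
    Integrable (fun ω => frobSq (X - Xhat ω)) P := by
  simp only [frobSq_sub_comm]
  refine integrable_finsetSum _ fun p _ => ?_
  have hmp : AEMeasurable (fun ω => Xhat ω p.1 p.2.1 p.2.2) P := by fun_prop
  refine Integrable.of_bound ((hmp.sub_const _).pow_const 2).aestronglyMeasurable (D ^ 2) ?_
  filter_upwards [hD] with ω h
  rw [Real.norm_eq_abs, abs_pow]
  gcongr
  exact h _ _ _

end Likelihood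

/-! ### Size of the number of levels. -/

section Levels

lemma le_numLevels {N : ℕ} (hN : 1 ≤ N) (β : ℝ) : (N : ℝ) ^ β ≤ numLevels N β := by
  have h0 : (0 : ℝ) < (N : ℝ) ^ β := Real.rpow_pos_of_pos (by exact_mod_cast hN) _
  rw [numLevels, Nat.cast_pow, Nat.cast_ofNat, ← Real.rpow_natCast,
    ← Real.logb_le_iff_le_rpow one_lt_two h0]
  exact Nat.le_ceil _

lemma numLevels_le {N : ℕ} (hN : 2 ≤ N) {β : ℝ} (hβ : 0 ≤ β) :
    (numLevels N β : ℝ) ≤ (N : ℝ) ^ (β + 1) := by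
  have hN' : (2 : ℝ) ≤ N := by exact_mod_cast hN
  have h0 : (0 : ℝ) < (N : ℝ) ^ β := Real.rpow_pos_of_pos (by linarith) _
  have h1 : (1 : ℝ) ≤ (N : ℝ) ^ β := Real.one_le_rpow (by linarith) hβ
  rw [numLevels, Nat.cast_pow, Nat.cast_ofNat, ← Real.rpow_natCast]
  calc (2 : ℝ) ^ ((⌈Real.logb 2 ((N : ℝ) ^ β)⌉₊ : ℕ) : ℝ) ≤ 2 ^ (Real.logb 2 ((N : ℝ) ^ β) + 1) :=
        Real.rpow_le_rpow_of_exponent_le one_le_two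
          (Nat.ceil_lt_add_one (Real.logb_nonneg one_lt_two h1)).le
    _ = (N : ℝ) ^ β * 2 := by
        rw [Real.rpow_add two_pos, Real.rpow_logb two_pos (by norm_num) h0, Real.rpow_one]
    -- Rounding the exponent up costs a factor 2 ≤ N, hence the exponent β + 1.
    _ ≤ _ := by
        rw [Real.rpow_add (by linarith), Real.rpow_one]
        gcongr

end Levels

/-! ### Numerical estimates and the basic inequality. -/

section Assembly

lemma nMax_mul_le_rpow {N : ℕ} (hN : 2 ≤ N) {β r : ℝ} (hr : 0 ≤ r)
    (hβ : 1 + Real.log (r + 1) / Real.log N ≤ β) : (N : ℝ) * (r + 1) ≤ (N : ℝ) ^ β := by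
  have hN' : (2 : ℝ) ≤ N := by exact_mod_cast hN
  have hl : 0 < Real.log N := Real.log_pos (by linarith)
  rw [Real.rpow_def_of_pos (by linarith), ← Real.log_le_iff_le_exp (by positivity),
    Real.log_mul (by linarith) (by linarith)]
  calc Real.log N + Real.log (r + 1) = Real.log N * (1 + Real.log (r + 1) / Real.log N) := by
        field_simp
    _ ≤ _ := by gcongr

lemma quantization_error_le {N F : ℕ} {a Xmax L : ℝ} (hN : 2 ≤ N) (hX : 0 < Xmax) (ha : 0 ≤ a)
    (hL : (N : ℝ) * (14 * F * a / Xmax + 1) ≤ L) : F * (6 * a / (L - 1)) ≤ Xmax / N := by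
  have hN' : (2 : ℝ) ≤ N := by exact_mod_cast hN
  have h0 : 0 ≤ F * a * N := by positivity
  have e : (N : ℝ) * (14 * F * a / Xmax + 1) = 14 * (F * a * N) / Xmax + N := by ring
  have h1 : 14 * (F * a * N) / Xmax + N ≤ L := e ▸ hL
  have h2 : 0 ≤ (F * a * N) / Xmax := by positivity
  have h3 : 14 * (F * a * N) / Xmax = 14 * ((F * a * N) / Xmax) := by ring
  have hL1 : 0 < L - 1 := by linarith
  have h4 : 7 * ((F * a * N) / Xmax) ≤ L - 1 := by linarith
  have h5 : 7 * (F * a * N) ≤ (L - 1) * Xmax := by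
    rw [← div_le_iff₀ hX, mul_div_assoc]; exact h4
  rw [mul_div_assoc', div_le_div_iff₀ hL1 (by linarith)]
  nlinarith

lemma mul_exp_neg_le_one {N n F : ℕ} {L β : ℝ} (hN : 2 ≤ N) (hn : n ≤ N) (hF : F ≤ N)
    (hβ : 1 ≤ β) (hL : L ≤ (N : ℝ) ^ (β + 1)) :
    (n : ℝ) * F * (L * Real.exp (-(2 * (β + 2) * Real.log N))) ≤ 1 := by
  have hN' : (2 : ℝ) ≤ N := by exact_mod_cast hN
  have hn' : (n : ℝ) ≤ N := by exact_mod_cast hn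
  have hF' : (F : ℝ) ≤ N := by exact_mod_cast hF
  have hN0 : (0 : ℝ) < N := by linarith
  have e : Real.exp (-(2 * (β + 2) * Real.log N)) = (N : ℝ) ^ (-(2 * (β + 2))) := by
    rw [Real.rpow_def_of_pos hN0]; ring_nf
  have hp : 0 < (N : ℝ) ^ (-(2 * (β + 2))) := Real.rpow_pos_of_pos hN0 _
  have h2 : L * (N : ℝ) ^ (-(2 * (β + 2))) ≤ (N : ℝ) ^ (-(β + 3)) := by
    calc _ ≤ (N : ℝ) ^ (β + 1) * (N : ℝ) ^ (-(2 * (β + 2))) := by gcongr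
      _ = _ := by rw [← Real.rpow_add hN0]; ring_nf
  rw [e]
  calc _ ≤ (n : ℝ) * F * (N : ℝ) ^ (-(β + 3)) := by gcongr
    _ ≤ (N : ℝ) * N * (N : ℝ) ^ (-(β + 3)) := by gcongr
    _ = (N : ℝ) ^ ((1 : ℝ) + 1 + (-(β + 3))) := by
        rw [Real.rpow_add hN0, Real.rpow_add hN0, Real.rpow_one]
    _ ≤ 1 := Real.rpow_le_one_of_one_le_of_nonpos (by linarith) (by linarith)

/-- Lets the squared rounding error Xmax²/N² be absorbed into Xmax² (n₁ + n₂)F/m. -/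
lemma volume_le {n₁ n₂ n₃ F : ℕ} (hF : 1 ≤ F) :
    (n₁ : ℝ) * n₂ * n₃ ≤ ((n₁ : ℝ) + n₂) * F * (nMax n₁ n₂ n₃ F : ℝ) ^ 2 := by
  have h2 : (n₂ : ℝ) ≤ nMax n₁ n₂ n₃ F := by exact_mod_cast (by unfold nMax; omega)
  have h3 : (n₃ : ℝ) ≤ nMax n₁ n₂ n₃ F := by exact_mod_cast (by unfold nMax; omega)
  have hF' : (1 : ℝ) ≤ F := by exact_mod_cast hF
  calc (n₁ : ℝ) * n₂ * n₃ = (n₁ : ℝ) * (n₂ * n₃) := by ring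
    _ ≤ (n₁ : ℝ) * (nMax n₁ n₂ n₃ F * nMax n₁ n₂ n₃ F) := by gcongr
    _ = (n₁ + 0) * 1 * (nMax n₁ n₂ n₃ F : ℝ) ^ 2 := by ring
    _ ≤ _ := by gcongr; positivity

/-- The per-entry risk bound that follows from the oracle inequality. -/
lemma risk_bound {N V m t σ Xmax QD β lg ℓ R k k' E D₀ : ℝ} (hN : 0 < N) (hV : 0 < V) (hm : 0 < m)
    (hmV : m ≤ V) (hσ : 0 < σ) (hQD : QD = 2 * Xmax ^ 2 / σ ^ 2)
    (ht : t = 1 / (2 * (1 + 2 * QD / 3))) (hβ : 1 ≤ β) (hlg : 0.69 ≤ lg) (hℓ : ℓ ≤ (β + 1) * lg)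
    (hR : 2 ≤ R) (hVR : V ≤ R * N ^ 2) (hk : 0 ≤ k') (hkk : k ≤ k')
    (hD : D₀ ≤ V * (Xmax / N) ^ 2)
    (h : m / V * t / (8 * σ ^ 2) * E ≤
      3 + m / V * t / (2 * σ ^ 2) * D₀ + (R * ℓ + 2 * (β + 2) * lg * k)) :
    E / V ≤ 48 * (β + 2) * (lg * (σ ^ 2 + Xmax ^ 2) * ((R + k') / m)) := by
  have hQ0 : 0 ≤ QD := by rw [hQD]; positivity
  have ht0 : 0 < t := by rw [ht]; positivity
  set W := 2 * (β + 2) * lg * (R + k') with hW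
  have hlg0 : 0 < lg := by linarith
  have hW0 : 0 ≤ W := by positivity
  have h1 : 3 + (R * ℓ + 2 * (β + 2) * lg * k) ≤ W := by
    have h2 : R * ℓ ≤ R * ((β + 1) * lg) := by gcongr
    have h3 : 2 * (β + 2) * lg * k ≤ 2 * (β + 2) * lg * k' := by gcongr
    have h4 : 2 * 0.69 ≤ R * lg := by gcongr
    have h5 : 3 ≤ 3 * (R * lg) := by linarith
    have h6 : 0 ≤ β * (R * lg) := by positivity
    rw [hW]; linarith
  have h2 : 8 * σ ^ 2 / t ≤ 22 * (σ ^ 2 + Xmax ^ 2) := by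
    have : 8 * σ ^ 2 / t = 16 * σ ^ 2 + 64 / 3 * Xmax ^ 2 := by
      rw [ht, hQD]; field_simp; ring
    rw [this]; nlinarith [sq_nonneg σ, sq_nonneg Xmax]
  have h3 : E / V ≤ 8 * σ ^ 2 / t * (W / m) + 4 * (D₀ / V) := by
    have h4 : m / V * t / (8 * σ ^ 2) * E ≤ W + m / V * t / (2 * σ ^ 2) * D₀ := by linarith
    have h5 := mul_le_mul_of_nonneg_left h4 (by positivity : 0 ≤ 8 * σ ^ 2 / (t * m))
    calc E / V = 8 * σ ^ 2 / (t * m) * (m / V * t / (8 * σ ^ 2) * E) := by field_simp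
      _ ≤ _ := h5
      _ = _ := by field_simp; ring
  have h4 : D₀ / V ≤ Xmax ^ 2 * (R / m) := by
    calc D₀ / V ≤ (Xmax / N) ^ 2 := by rw [div_le_iff₀ hV]; linarith
      _ = Xmax ^ 2 * (1 / N ^ 2) := by rw [div_pow]; ring
      _ ≤ Xmax ^ 2 * (R / V) := by
        refine mul_le_mul_of_nonneg_left ?_ (sq_nonneg _)
        rw [div_le_div_iff₀ (by positivity) hV]; linarith
      _ ≤ _ := by gcongr
  have h5 : 8 * σ ^ 2 / t * (W / m) ≤ 22 * (σ ^ 2 + Xmax ^ 2) * (W / m) := by gcongr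
  have h6 : Xmax ^ 2 * (R / m) ≤ (β + 2) * lg * ((σ ^ 2 + Xmax ^ 2) * ((R + k') / m)) := by
    have h7 : 1 ≤ (β + 2) * lg := by nlinarith
    have h8 : Xmax ^ 2 * (R / m) ≤ (σ ^ 2 + Xmax ^ 2) * ((R + k') / m) := by
      gcongr
      · nlinarith [sq_nonneg σ]
      · linarith
    exact h8.trans (le_mul_of_one_le_left (by positivity) h7)
  have h7 : 22 * (σ ^ 2 + Xmax ^ 2) * (W / m) =
      44 * ((β + 2) * lg * ((σ ^ 2 + Xmax ^ 2) * ((R + k') / m))) := by rw [hW]; ring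
  -- 48 = 44 + 4: code length (22 times the 2 in `W`) plus rounding error.
  calc E / V ≤ 48 * ((β + 2) * lg * ((σ ^ 2 + Xmax ^ 2) * ((R + k') / m))) := by linarith
    _ = _ := by ring

lemma mul_sq_le {σ Xmax QD t : ℝ} (hσ : 0 < σ) (hQD : QD = 2 * Xmax ^ 2 / σ ^ 2)
    (ht : t = 1 / (2 * (1 + 2 * QD / 3))) : t * (3 / 2 * Xmax) ^ 2 ≤ 2 * σ ^ 2 := by
  have e : 2 * (1 + 2 * QD / 3) = (2 * σ ^ 2 + 8 / 3 * Xmax ^ 2) / σ ^ 2 := by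
    rw [hQD]; field_simp; ring
  rw [ht, e, one_div, inv_div, div_mul_eq_mul_div, div_le_iff₀ (by positivity)]
  nlinarith [sq_nonneg (σ * Xmax), sq_nonneg (σ ^ 2)]

/-- The basic inequality for the estimate, in terms of codes. -/
lemma IsEstimate.exists_code {n₁ n₂ n₃ F L : ℕ} {Amax Bmax Cmax Xmax σ lam t ℓ w : ℝ}
    (hσ : 0 < σ) (ht : 0 ≤ t) (hw : t * lam = w) {X Y Xhat : Tensor n₁ n₂ n₃}
    {S : Set (Index n₁ n₂ n₃)} {x : Index n₁ n₂ n₃ → ℝ}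
    (hY : ∀ p ∈ S, Y p.1 p.2.1 p.2.2 = X p.1 p.2.1 p.2.2 + x p)
    (h : IsEstimate F L Amax Bmax Cmax Xmax σ lam S Y Xhat)
    {A : Matrix (Fin n₁) (Fin F) ℝ} {B : Matrix (Fin n₂) (Fin F) ℝ}
    {C : Matrix (Fin n₃) (Fin F) ℝ} (hcand : IsCandidate L Amax Bmax Cmax Xmax A B C) :
    ∃ θ : Code n₁ n₂ n₃ F L, θ.decode Amax Bmax Cmax = Xhat ∧
      t * llr (σ ^ 2) (fun p => Xhat p.1 p.2.1 p.2.2 - X p.1 p.2.1 p.2.2) (S, x) + θ.length ℓ w ≤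
      t * llr (σ ^ 2) (fun p => cp A B C p.1 p.2.1 p.2.2 - X p.1 p.2.1 p.2.2) (S, x) +
        (((n₁ : ℝ) + n₂) * F * ℓ + w * nnzCount C) := by
  obtain ⟨A₁, B₁, C₁, hc, rfl, hmin⟩ := h
  obtain ⟨θ, hθ, hlen⟩ := SparseCP.exists_code hc ℓ w
  refine ⟨θ, hθ, ?_⟩
  have h1 := hmin A B C hcand
  unfold objective at h1
  rw [hlen, ← neg_log_likelihood_sub hσ _ _ Y S x hY, ← neg_log_likelihood_sub hσ _ _ Y S x hY,
    ← hw]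
  nlinarith [mul_le_mul_of_nonneg_left h1 ht]

end Assembly

end SparseCP

/-! ### Proof of the theorem. -/

theorem corollary1 :
    ∃ K : ℝ, 0 < K ∧
      ∀ (n₁ n₂ n₃ F : ℕ), 1 ≤ n₁ → 1 ≤ n₂ → 1 ≤ n₃ → 1 ≤ F → 2 ≤ SparseCP.nMax n₁ n₂ n₃ F →
      ∀ (Amax Bmax Cmax Xmax σ : ℝ), 0 < Xmax → 0 < σ →
      ∀ (A : Matrix (Fin n₁) (Fin F) ℝ) (B : Matrix (Fin n₂) (Fin F) ℝ)
        (C : Matrix (Fin n₃) (Fin F) ℝ),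
      (∀ i f, |A i f| ≤ Amax) → (∀ j f, |B j f| ≤ Bmax) → (∀ k f, |C k f| ≤ Cmax) →
      (∀ i j k, |SparseCP.cp A B C i j k| ≤ Xmax / 2) →
      ∀ (m : ℝ) (γ : unitInterval), 0 < m → m ≤ (n₁ : ℝ) * n₂ * n₃ →
      (γ : ℝ) = m / ((n₁ : ℝ) * n₂ * n₃) →
      ∀ (QD β lam : ℝ), QD = 2 * Xmax ^ 2 / σ ^ 2 →
      β = max 1 (1 + Real.log (14 * F * Amax * Bmax * Cmax / Xmax + 1) /
        Real.log (SparseCP.nMax n₁ n₂ n₃ F)) →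
      lam = 4 * (1 + 2 * QD / 3) * (β + 2) * Real.log (SparseCP.nMax n₁ n₂ n₃ F) →
      ∀ (Ω : Type*) [MeasurableSpace Ω] (P : Measure Ω) [IsProbabilityMeasure P]
        (S : Ω → Set (SparseCP.Index n₁ n₂ n₃)) (noise : SparseCP.Index n₁ n₂ n₃ → Ω → ℝ)
        (Y Xhat : Ω → SparseCP.Tensor n₁ n₂ n₃),
      SparseCP.IsObservation P (SparseCP.cp A B C) σ γ S noise Y →
      AEMeasurable Xhat P →
      (∀ᵐ ω ∂P, SparseCP.IsEstimate F (SparseCP.numLevels (SparseCP.nMax n₁ n₂ n₃ F) β)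
        Amax Bmax Cmax Xmax σ lam (S ω) (Y ω) (Xhat ω)) →
      Integrable (fun ω => SparseCP.frobSq (SparseCP.cp A B C - Xhat ω)) P ∧
      (∫ ω, SparseCP.frobSq (SparseCP.cp A B C - Xhat ω) ∂P) / ((n₁ : ℝ) * n₂ * n₃) ≤
        K * (β + 2) * (Real.log (SparseCP.nMax n₁ n₂ n₃ F) * (σ ^ 2 + Xmax ^ 2) *
          ((((n₁ : ℝ) + n₂) * F + SparseCP.nnzCount C) / m)) := by
  classical
  refine ⟨48, by norm_num, ?_⟩
  intro n₁ n₂ n₃ F h₁ h₂ h₃ hF hN Amax Bmax Cmax Xmax σ hX hσ A B C hA hB hC hcp m γ hm hmV hγ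
    QD β lam hQD hβ hlam Ω _ P _ S noise Y Xhat hobs hmeas hest
  set N := SparseCP.nMax n₁ n₂ n₃ F with hNdef
  set L := SparseCP.numLevels N β with hLdef
  have hA0 : 0 ≤ Amax := (abs_nonneg _).trans (hA ⟨0, h₁⟩ ⟨0, hF⟩)
  have hB0 : 0 ≤ Bmax := (abs_nonneg _).trans (hB ⟨0, h₂⟩ ⟨0, hF⟩)
  have hC0 : 0 ≤ Cmax := (abs_nonneg _).trans (hC ⟨0, h₃⟩ ⟨0, hF⟩)
  have hN' : (2 : ℝ) ≤ N := by exact_mod_cast hN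
  have hlog : 0.69 ≤ Real.log N := by
    have := Real.log_le_log two_pos hN'
    linarith [Real.log_two_gt_d9]
  have hβ1 : 1 ≤ β := hβ ▸ le_max_left _ _
  have hLN : (N : ℝ) * (14 * F * (Amax * Bmax * Cmax) / Xmax + 1) ≤ L := by
    refine le_trans (SparseCP.nMax_mul_le_rpow hN (by positivity) ?_)
      (SparseCP.le_numLevels (by omega) β)
    rw [show (14 * F * (Amax * Bmax * Cmax) : ℝ) = 14 * F * Amax * Bmax * Cmax by ring]
    exact hβ ▸ le_max_right _ _
  have hL2' : (2 : ℝ) ≤ L := by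
    have : 0 ≤ 14 * F * (Amax * Bmax * Cmax) / Xmax := by positivity
    nlinarith
  have hL2 : 2 ≤ L := by exact_mod_cast hL2'
  have hLle : (L : ℝ) ≤ (N : ℝ) ^ (β + 1) := SparseCP.numLevels_le hN (by linarith)
  have hlogL : Real.log L ≤ (β + 1) * Real.log N := by
    rw [← Real.log_rpow (by linarith)]
    exact Real.log_le_log (by linarith) hLle
  obtain ⟨A', B', C', hA', hB', hC', hnnz, hq⟩ := SparseCP.exists_quantization hL2 hA hB hC
  have hq' (i j k) : |SparseCP.cp A' B' C' i j k - SparseCP.cp A B C i j k| ≤ Xmax / N :=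
    (hq i j k).trans (SparseCP.quantization_error_le hN hX (by positivity) hLN)
  have hcand : SparseCP.IsCandidate L Amax Bmax Cmax Xmax A' B' C' := by
    refine ⟨hA', hB', hC', fun i j k => ?_⟩
    -- The margin between the bound Xmax/2 on the truth and Xmax on candidates absorbs the rounding.
    have h1 : Xmax / N ≤ Xmax / 2 := by gcongr
    have h2 := abs_sub_abs_le_abs_sub (SparseCP.cp A' B' C' i j k) (SparseCP.cp A B C i j k)
    linarith [hq' i j k, hcp i j k]
  have hbound : ∀ᵐ ω ∂P, ∀ i j k, |Xhat ω i j k - SparseCP.cp A B C i j k| ≤ 3 / 2 * Xmax := by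
    filter_upwards [hest] with ω ⟨A₁, B₁, C₁, hc, he, _⟩ i j k
    rw [he]
    refine (abs_sub _ _).trans ?_
    linarith [hc.2.2.2 i j k, hcp i j k]
  have hint := SparseCP.integrable_frobSq_sub hmeas hbound
  refine ⟨hint, ?_⟩
  have hQ0 : 0 ≤ QD := by rw [hQD]; positivity
  set t := 1 / (2 * (1 + 2 * QD / 3)) with ht
  have ht0 : 0 < t := by positivity
  have ht2 : t ≤ 1 / 2 := by
    rw [ht]
    exact one_div_le_one_div_of_le two_pos (by linarith)
  have hw : t * lam = 2 * (β + 2) * Real.log N := by rw [ht, hlam]; field_simp; ring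
  have hσ2 : ((σ ^ 2).toNNReal : ℝ) = σ ^ 2 := Real.coe_toNNReal _ (by positivity)
  have hσ0 : (σ ^ 2).toNNReal ≠ 0 := (Real.toNNReal_pos.2 (by positivity)).ne'
  have horacle := SparseCP.oracle_inequality hσ0 hobs.hasLaw (t := t) (D := 3 / 2 * Xmax) (M := 3)
    ht0.le ht2 (by rw [hσ2]; exact SparseCP.mul_sq_le hσ hQD ht)
    -- Arbitrary codes may decode to large tensors, so only those within Xmax + Xmax/2 of the truth
    -- are kept; the estimate is among them.
    (Finset.univ.filter fun θ : SparseCP.Code n₁ n₂ n₃ F L => ∀ p : SparseCP.Index n₁ n₂ n₃,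
      |θ.decode Amax Bmax Cmax p.1 p.2.1 p.2.2 - SparseCP.cp A B C p.1 p.2.1 p.2.2| ≤ 3 / 2 * Xmax)
    (fun θ p => θ.decode Amax Bmax Cmax p.1 p.2.1 p.2.2 - SparseCP.cp A B C p.1 p.2.1 p.2.2)
    (fun θ hθ => (Finset.mem_filter.1 hθ).2)
    (fun θ => θ.length (Real.log L) (2 * (β + 2) * Real.log N))
    ((Finset.sum_le_univ_sum_of_nonneg fun _ => (Real.exp_pos _).le).trans
      (SparseCP.sum_exp_neg_length_le (by omega) _ (SparseCP.mul_exp_neg_le_one hN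
        (by rw [hNdef, SparseCP.nMax]; omega) (by rw [hNdef, SparseCP.nMax]; omega) hβ1 hLle)))
    (fun p => SparseCP.cp A' B' C' p.1 p.2.1 p.2.2 - SparseCP.cp A B C p.1 p.2.1 p.2.2)
    (((n₁ : ℝ) + n₂) * F * Real.log L + 2 * (β + 2) * Real.log N * SparseCP.nnzCount C')
    hint (by
      filter_upwards [hest, hbound] with ω he hb
      obtain ⟨θ, hθ, hle⟩ := he.exists_code (ℓ := Real.log L) hσ ht0.le hw
        (hobs.observed ω) hcand
      refine ⟨θ, Finset.mem_filter.2 ⟨Finset.mem_univ _, fun p => hθ ▸ hb _ _ _⟩, ?_, ?_⟩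
      · rw [SparseCP.frobSq_sub_comm, hθ]
      · rw [hσ2, hθ]
        exact hle)
  rw [hσ2, hγ] at horacle
  refine SparseCP.risk_bound (N := N) (by linarith) (by positivity) hm hmV hσ hQD ht hβ1 hlog hlogL
    ?_ (SparseCP.volume_le hF) (Nat.cast_nonneg _) (Nat.cast_le.2 hnnz) ?_ horacle
  · have e1 : (1 : ℝ) ≤ n₁ := by exact_mod_cast h₁
    have e2 : (1 : ℝ) ≤ n₂ := by exact_mod_cast h₂
    have e3 : (1 : ℝ) ≤ F := by exact_mod_cast hF
    nlinarith
  · refine (Finset.sum_le_card_nsmul _ _ ((Xmax / N) ^ 2) fun p _ => ?_).trans_eq ?_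
    · rw [← sq_abs]
      gcongr
      exact hq' _ _ _
    · simp [Fintype.card_prod, mul_assoc]
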